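/- Fix constants $\epsilon\in(0,1)$, a real $p\ge 2$ and $\delta_0\in(0,1)$. For a stream $a_1,\dots,a_m$ of items of $[n]=\{1,\dots,n\}$ let $x_j$ be the number of occurrences of $j$, and let $F_p=\sum_{j=1}^n x_j^p$. A $\delta$-error $r$-pass insertion-only streaming algorithm for $\epsilon$-$F_p$-estimation on streams of length at most $L$ is a randomized algorithm that reads the stream $r$ times in order and, on every stream of at most $L$ items of $[n]$, outputs with probability at least $1-\delta$ a real number $z$ with $(1-\epsilon)F_p\le z\le(1+\epsilon)F_p$. It uses $S$ bits of space if the only information carried from one arrival of an item to the next, and from one pass to the next, is a string of $S$ bits; its computation per item is unrestricted, it may flip fresh coins at each step, it knows which pass it is in and when a pass ends, and it may also consult a random string, drawn once, that is not charged to its space. There are $c>0$ and $n_0$, depending only on $\epsilon$, $p$ and $\delta_0$, such that for all $n\ge n_0$, $L\ge n$ (for instance any polynomial bound $L=n^a$ with $a\ge1$), $r\ge1$ and $\delta\in[0,\delta_0]$, every $\delta$-error $r$-pass insertion-only streaming algorithm for $\epsilon$-$F_p$-estimation on streams of length at most $L$ uses at least $$c\cdot\min\left(\frac{n^{1-1/p}}{r},\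 \frac{n^{1-2/p}\log(1/\delta)}{r}\right)$$ bits of space, where for $\delta=0$ (with $\log(1/0)=\infty$) the minimum is $n^{1-1/p}/r$. -/

import Mathlib

/-- The contents of a memory of `S` bits. -/
abbrev Memory (S : ℕ) : Type := Fin S → Bool

/-- A randomized algorithm that makes `r` passes over an insertion-only stream of items of
`{1, …, n}` (here `Fin n`) and keeps `S` bits of memory between any two arrivals.

The only thing carried from one arrival to the next, and from one pass to the next, is the
memory. Each action may flip fresh coins, and its cost is not bounded. The algorithm may in
addition consult a random string `Seed`, drawn once, which is not charged to its space; an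
algorithm that has no such string takes a one-point `Seed`. The algorithm is told when a pass
ends and which pass it is in. -/
structure StreamingAlgorithm (n r S : ℕ) where
  /-- values of the uncharged random string -/
  Seed : Type
  /-- law of the uncharged random string -/
  seed : PMF Seed
  /-- initial memory -/
  init : Seed → PMF (Memory S)
  /-- action in the given pass when the given item arrives -/
  update : Seed → Fin r → Fin n → Memory S → PMF (Memory S)
  /-- action at the end of the given pass -/
  endPass : Seed → Fin r → Memory S → PMF (Memory S)
  /-- output after the last pass -/
  output : Seed → Memory S → PMF ℝ

namespace StreamingAlgorithm

variable {n r S : ℕ}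

/-- Law of the memory after the items of a list have arrived one by one during pass `i`, if the
memory was `s` before. -/
noncomputable def readItems (A : StreamingAlgorithm n r S) (ρ : A.Seed) (i : Fin r) :
    List (Fin n) → Memory S → PMF (Memory S)
  | [], s => PMF.pure s
  | a :: as, s => (A.update ρ i a s).bind (A.readItems ρ i as)

/-- Law of the memory after the whole pass `i`, if the memory was `s` before. -/
noncomputable def runPass (A : StreamingAlgorithm n r S) (ρ : A.Seed) (σ : List (Fin n))
    (i : Fin r) (s : Memory S) : PMF (Memory S) :=
  (A.readItems ρ i σ s).bind (A.endPass ρ i)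

/-- Law of the memory after all `r` passes over the stream `σ`, in order. -/
noncomputable def finalMemory (A : StreamingAlgorithm n r S) (ρ : A.Seed) (σ : List (Fin n)) :
    PMF (Memory S) :=
  (List.finRange r).foldl (fun μ i => μ.bind (A.runPass ρ σ i)) (A.init ρ)

/-- Law of the output on the stream `σ`. -/
noncomputable def outputLaw (A : StreamingAlgorithm n r S) (σ : List (Fin n)) : PMF ℝ :=
  A.seed.bind fun ρ => (A.finalMemory ρ σ).bind (A.output ρ)

end StreamingAlgorithm

/-- The frequency moment `F_p = ∑ⱼ xⱼ ^ p`, where `xⱼ` is the number of occurrences of `j`. -/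
noncomputable def frequencyMoment {n : ℕ} (p : ℝ) (σ : List (Fin n)) : ℝ :=
  ∑ j : Fin n, (σ.count j : ℝ) ^ p

/-- `A` is a `δ`-error algorithm for `ε`-`F_p`-estimation on streams of length at most `L`: on
each such stream, its output `z` violates `(1 - ε) F_p ≤ z ≤ (1 + ε) F_p` with probability at
most `δ`. -/
def StreamingAlgorithm.EstimatesMoment {n r S : ℕ} (A : StreamingAlgorithm n r S)
    (L : ℕ) (p ε δ : ℝ) : Prop :=
  ∀ σ : List (Fin n), σ.length ≤ L →
    (A.outputLaw σ).toOuterMeasure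
      {z | ¬ ((1 - ε) * frequencyMoment p σ ≤ z ∧ z ≤ (1 + ε) * frequencyMoment p σ)}
        ≤ ENNReal.ofReal δ

/-- `min (n ^ (1 - 1/p) / r) (n ^ (1 - 2/p) * log (1/δ) / r)`, where `log (1/0) = ∞`. -/
noncomputable def momentSpaceBound (n r : ℕ) (p δ : ℝ) : ℝ :=
  if δ = 0 then (n : ℝ) ^ (1 - 1 / p) / r
  else min ((n : ℝ) ^ (1 - 1 / p) / r) ((n : ℝ) ^ (1 - 2 / p) * Real.log (1 / δ) / r)

/-! The hard streams come from `k` players, about `n ^ (1/p)` up to a constant. Each of `N = n / 2`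
items has an owner, who holds it or not by a fair coin, so this background contributes at most `n`
to the moment. One item `j` is planted: it is held by nobody (the baseline) or by a random half of a
set `T` of players. With `n ≤ #T ^ p`, the moment then has order `#T ^ p`, except with probability
exponentially small in `#T`. Sets `T` of `m + 1` well separated sizes have disjoint windows of
acceptable estimates, so the output on a baseline stream misses `m` windows on average, although
each window is missed with probability at most `δ` plus a small tail when its own set is planted.

A small memory forbids this gap. The messages between players form a transcript whose probability is
a product of factors, one per player. Hence the divergence of the baseline from the planted law
splits into one leak per player of `T`. The leak to the owner is the information about one of many
independent bits, so these leaks total at most `2 log |Ω|` over all items (`sum_leak_owner_le`). The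
planted inputs do not depend on the owner of `j`, so the owner may be resampled, and all leaks
together average at most `2 k log |Ω| / N` (`expect_leak_le`). The log of the number of transcripts
is of order `S k r`.

A variational bound on the divergence (`mul_sum_plantedLaw_le`) compares the chance of missing a
window in the two cases, with a free parameter `t`. In `memory_error_tradeoff` this gives `t * m /
(m + 1) ≤ O(k² r S / n) + (exp t - 1) * (δ + tail)`. Taking `t` of order `min (log (1/δ)) (n ^
(1/p))` makes the last term a fraction of `t` below `m / (m + 1)`, and the bound on `S` follows. -/

open Finset
open scoped BigOperators

/-! ### Uniform averages over product spaces -/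

section Expectation

/-- Resampling one coordinate of a uniform function does not change expectations. -/
theorem expect_expect_update {α β : Type*} [Fintype α] [DecidableEq α] [Fintype β] [Nonempty β]
    (a : α) (f : (α → β) → ℝ) :
    𝔼 z, 𝔼 b, f (Function.update z a b) = 𝔼 z, f z := by
  have hinv : Function.Involutive
      (fun q : (α → β) × β => (Function.update q.1 a q.2, q.1 a)) := by
    rintro ⟨z, b⟩
    simp
  have h := Fintype.expect_equiv hinv.toPerm (fun q : (α → β) × β => f (Function.update q.1 a q.2))
    (fun q => f q.1) (fun _ => rfl)
  rw [← univ_product_univ, expect_product, expect_product] at h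
  rw [h]
  simp

theorem prod_expect {ι : Type*} [Fintype ι] [DecidableEq ι] {κ : ι → Type*} [∀ i, Fintype (κ i)]
    (f : ∀ i, κ i → ℝ) :
    ∏ i, 𝔼 b, f i b = 𝔼 B : ∀ i, κ i, ∏ i, f i (B i) := by
  simp only [Fintype.expect_eq_sum_div_card, prod_div_distrib, Fintype.prod_sum, Fintype.card_pi,
    Nat.cast_prod]

theorem expect_bool (f : Bool → ℝ) : 𝔼 b, f b = (f true + f false) / 2 := by
  rw [Fintype.expect_eq_sum_div_card]
  simp

end Expectation

/-! ### Divergence and the information carried by independent bits -/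

section Divergence

variable {Ω : Type*}

/-- Kullback–Leibler divergence of nonnegative functions on a finite type. -/
noncomputable def klSum [Fintype Ω] (P Q : Ω → ℝ) : ℝ := ∑ π, P π * Real.log (P π / Q π)

theorem klSum_nonneg [Fintype Ω] {P Q : Ω → ℝ} (hP : ∀ π, 0 ≤ P π) (hQ : ∀ π, 0 ≤ Q π)
    (hPQ : ∀ π, Q π = 0 → P π = 0) (h : ∑ π, P π = ∑ π, Q π) : 0 ≤ klSum P Q := by
  have key : ∀ π, P π - Q π ≤ P π * Real.log (P π / Q π) := by
    intro π
    rcases (hP π).eq_or_lt with h0 | h0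
    · simp [← h0, hQ π]
    have hq : 0 < Q π := (hQ π).lt_of_ne fun hq => h0.ne' (hPQ π hq.symm)
    have := Real.one_sub_inv_le_log_of_pos (div_pos h0 hq)
    calc P π - Q π = P π * (1 - (P π / Q π)⁻¹) := by field_simp
      _ ≤ _ := mul_le_mul_of_nonneg_left this h0.le
  calc (0 : ℝ) = ∑ π, (P π - Q π) := by rw [sum_sub_distrib, h, sub_self]
    _ ≤ _ := sum_le_sum fun π _ => key π

variable {ι : Type*} [Fintype ι] [DecidableEq ι]

/-- The law of the output of the channel `W` when the input is uniform, except that the bit `a`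
is set to `b`. -/
noncomputable def condLaw (W : (ι → Bool) → Ω → ℝ) (a : ι) (b : Bool) (π : Ω) : ℝ :=
  𝔼 B, W (Function.update B a b) π

theorem expect_condLaw (W : (ι → Bool) → Ω → ℝ) (a : ι) (π : Ω) :
    𝔼 b, condLaw W a b π = 𝔼 B, W B π := by
  simp only [condLaw]
  rw [expect_comm, expect_expect_update a fun B => W B π]

theorem condLaw_nonneg {W : (ι → Bool) → Ω → ℝ} (h0 : ∀ B π, 0 ≤ W B π) (a : ι) (b : Bool) (π : Ω) :
    0 ≤ condLaw W a b π :=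
  expect_nonneg fun _ _ => h0 _ _

theorem sum_condLaw [Fintype Ω] {W : (ι → Bool) → Ω → ℝ} (h1 : ∀ B, ∑ π, W B π = 1) (a : ι) (b : Bool) :
    ∑ π, condLaw W a b π = 1 := by
  simp only [condLaw]
  rw [← expect_sum_comm]
  simp [h1]

theorem condLaw_self_pos {W : (ι → Bool) → Ω → ℝ} (h0 : ∀ B π, 0 ≤ W B π) {B : ι → Bool} {π : Ω}
    (h : 0 < W B π) (a : ι) : 0 < condLaw W a (B a) π :=
  expect_pos' (fun _ _ => h0 _ _) ⟨B, mem_univ _, by simpa using h⟩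

/-- The bits of a uniform input jointly reveal at most `log |Ω|` through a channel with outputs
in `Ω`. -/
theorem sum_expect_klSum_condLaw_le [Fintype Ω] [Nonempty Ω] {W : (ι → Bool) → Ω → ℝ}
    (h0 : ∀ B π, 0 ≤ W B π) (h1 : ∀ B, ∑ π, W B π = 1) :
    ∑ a, 𝔼 b, klSum (condLaw W a b) (fun π => 𝔼 B, W B π) ≤ Real.log (Fintype.card Ω) := by
  set V : Ω → ℝ := fun π => 𝔼 B, W B π with hV
  set c : ℝ := (Fintype.card Ω : ℝ) with hc
  have hcpos : 0 < c := by rw [hc]; exact_mod_cast Fintype.card_pos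
  have hV0 : ∀ π, 0 ≤ V π := fun π => expect_nonneg fun _ _ => h0 _ _
  have hW1 : ∀ B π, W B π ≤ 1 := fun B π => by
    rw [← h1 B]
    exact single_le_sum (fun π _ => h0 B π) (mem_univ π)
  have hexp : ∀ a, 𝔼 b, klSum (condLaw W a b) V
      = ∑ π, 𝔼 B, W B π * Real.log (condLaw W a (B a) π / V π) := by
    intro a
    simp only [klSum]
    rw [expect_sum_comm]
    refine sum_congr rfl fun π _ => ?_
    rw [← expect_expect_update a fun B => W B π * Real.log (condLaw W a (B a) π / V π), expect_comm]
    refine expect_congr rfl fun b _ => ?_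
    conv_lhs => rw [condLaw, expect_mul]
    simp [condLaw]
  -- No chain rule is needed: `log x ≤ x - 1` is applied to the product of all likelihood ratios
  -- divided by `c`, and `W B π ≤ 1` then removes the weight in front of that product.
  have hpt : ∀ B π, ∑ a, W B π * Real.log (condLaw W a (B a) π / V π)
      ≤ (∏ a, (condLaw W a (B a) π / V π)) / c + W B π * (Real.log c - 1) := by
    intro B π
    have hnn : ∀ a, 0 ≤ condLaw W a (B a) π / V π :=
      fun a => div_nonneg (condLaw_nonneg h0 _ _ _) (hV0 π)
    rcases (h0 B π).eq_or_lt with h | h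
    · have := div_nonneg (prod_nonneg fun a (_ : a ∈ univ) => hnn a) hcpos.le
      rw [← h]
      simpa only [zero_mul, sum_const_zero, add_zero] using this
    have hVpos : 0 < V π := expect_pos' (fun _ _ => h0 _ _) ⟨B, mem_univ _, h⟩
    have hpos : ∀ a, 0 < condLaw W a (B a) π / V π :=
      fun a => div_pos (condLaw_self_pos h0 h a) hVpos
    set Y := ∏ a, (condLaw W a (B a) π / V π) with hY
    have hYpos : 0 < Y := prod_pos fun a _ => hpos a
    rw [← mul_sum, ← Real.log_prod fun a _ => (hpos a).ne', ← hY]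
    have hlog := Real.log_le_sub_one_of_pos (div_pos hYpos hcpos)
    rw [Real.log_div hYpos.ne' hcpos.ne'] at hlog
    calc W B π * Real.log Y ≤ W B π * (Y / c + (Real.log c - 1)) :=
          mul_le_mul_of_nonneg_left (by linarith) h.le
      _ = W B π * (Y / c) + W B π * (Real.log c - 1) := by ring
      _ ≤ 1 * (Y / c) + W B π * (Real.log c - 1) := by
          gcongr
          exact hW1 B π
      _ = _ := by ring
  -- The bits are independent, so the mean of the product factors, and each factor is `V π / V π`.
  have hprod : ∀ π, 𝔼 B : ι → Bool, ∏ a, (condLaw W a (B a) π / V π) ≤ 1 := by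
    intro π
    rw [← prod_expect fun a b => condLaw W a b π / V π]
    refine prod_le_one (fun a _ => expect_nonneg fun b _ =>
      div_nonneg (condLaw_nonneg h0 _ _ _) (hV0 π)) fun a _ => ?_
    rw [← expect_div, expect_condLaw]
    exact div_self_le_one _
  calc ∑ a, 𝔼 b, klSum (condLaw W a b) V
      = ∑ π, 𝔼 B, ∑ a, W B π * Real.log (condLaw W a (B a) π / V π) := by
        simp only [hexp, expect_sum_comm]
        rw [sum_comm]
    _ ≤ ∑ π, 𝔼 B, ((∏ a, (condLaw W a (B a) π / V π)) / c + W B π * (Real.log c - 1)) :=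
        sum_le_sum fun π _ => expect_le_expect fun B _ => hpt B π
    _ = ∑ π, ((𝔼 B : ι → Bool, ∏ a, (condLaw W a (B a) π / V π)) / c + V π * (Real.log c - 1)) := by
        refine sum_congr rfl fun π _ => ?_
        rw [expect_add_distrib, expect_div, hV, expect_mul]
    _ ≤ ∑ π, (1 / c + V π * (Real.log c - 1)) := by
        gcongr with π
        exact hprod π
    _ = Real.log c := by
        have hVs : ∑ π, V π = 1 := by
          rw [hV, ← expect_sum_comm]
          simp [h1]
        rw [sum_add_distrib, ← sum_mul, hVs, sum_const, card_univ, nsmul_eq_mul, ← hc]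
        field_simp
        ring

/-- The value `false` carries half of the average over a bit and the other half is nonnegative,
whence the factor 2. -/
theorem sum_klSum_condLaw_false_le [Fintype Ω] [Nonempty Ω] {W : (ι → Bool) → Ω → ℝ}
    (h0 : ∀ B π, 0 ≤ W B π) (h1 : ∀ B, ∑ π, W B π = 1) (s : Finset ι) :
    ∑ a ∈ s, klSum (condLaw W a false) (fun π => 𝔼 B, W B π) ≤ 2 * Real.log (Fintype.card Ω) := by
  have hnn : ∀ a b, 0 ≤ klSum (condLaw W a b) (fun π => 𝔼 B, W B π) := by
    intro a b
    refine klSum_nonneg (condLaw_nonneg h0 _ _) (fun π => expect_nonneg fun _ _ => h0 _ _)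
      (fun π hπ => ?_) ?_
    · have h := expect_condLaw W a π
      rw [hπ, expect_bool] at h
      have h2 := condLaw_nonneg h0 a true π
      have h3 := condLaw_nonneg h0 a false π
      cases b <;> linarith
    · rw [sum_condLaw h1, ← expect_sum_comm]
      simp [h1]
  refine (sum_le_univ_sum_of_nonneg fun a => hnn a false).trans ?_
  have h := sum_expect_klSum_condLaw_le h0 h1
  simp only [expect_bool, ← sum_div, sum_add_distrib] at h
  have := sum_nonneg fun a (_ : a ∈ univ) => hnn a true
  linarith

end Divergence

/-! ### Product-form protocols and the leak about a planted item -/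

section Protocol

/-- The transcript probabilities of a number-in-hand protocol in which every player holds a subset
of `J`: for each transcript they split into a product of factors, one per player. -/
structure RectangleProtocol (κ J Ω : Type*) [Fintype κ] [Fintype Ω] where
  base : Ω → ℝ
  factor : κ → Ω → (J → Bool) → ℝ
  base_nonneg : ∀ π, 0 ≤ base π
  factor_nonneg : ∀ i π x, 0 ≤ factor i π x
  sum_eq_one : ∀ X : κ → J → Bool, ∑ π, base π * ∏ i, factor i π (X i) = 1

variable {κ J Ω : Type*}

/-- The inputs in which every item `j' ≠ j` may be held by its owner `z j'` only, as the bits `B`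
tell, and `j` is held by the players of `S`. -/
def plantedInput [DecidableEq κ] [DecidableEq J] (z : J → κ) (j : J) (S : κ → Bool)
    (B : κ → J → Bool) : κ → J → Bool :=
  fun i j' => if j' = j then S i else decide (z j' = i) && B i j'

/-- The entry `z j` is never read. This is what later lets the owner of the planted item be
resampled. -/
theorem plantedInput_update [DecidableEq κ] [DecidableEq J] (z : J → κ) (j : J) (i : κ) :
    plantedInput (Function.update z j i) j = plantedInput z j := by
  ext S B i' j'
  by_cases h : j' = j <;> simp [plantedInput, h]

theorem exp_mul_le {t e : ℝ} (h0 : 0 ≤ e) (h1 : e ≤ 1) :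
    Real.exp (t * e) ≤ 1 + (Real.exp t - 1) * e := by
  have := convexOn_exp.2 (Set.mem_univ 0) (Set.mem_univ t) (sub_nonneg.2 h1) h0 (by ring)
  simp only [smul_eq_mul, mul_zero, zero_add, Real.exp_zero, mul_one] at this
  rw [mul_comm t e]
  linarith

namespace RectangleProtocol

variable [Fintype κ] [Fintype Ω] (P : RectangleProtocol κ J Ω)

/-- Law of the transcript on the input `X`. -/
def law (X : κ → J → Bool) (π : Ω) : ℝ := P.base π * ∏ i, P.factor i π (X i)

theorem law_nonneg (X : κ → J → Bool) (π : Ω) : 0 ≤ P.law X π :=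
  mul_nonneg (P.base_nonneg π) (prod_nonneg fun _ _ => P.factor_nonneg _ _ _)

theorem sum_law (X : κ → J → Bool) : ∑ π, P.law X π = 1 := P.sum_eq_one X

variable [DecidableEq κ] [Fintype J] [DecidableEq J]

/-- Law of the transcript when the item `j` is planted with the players of `S`. -/
noncomputable def plantedLaw (z : J → κ) (j : J) (S : κ → Bool) (π : Ω) : ℝ :=
  𝔼 B, P.law (plantedInput z j S B) π

/-- The factor of player `i`, averaged over the part of the input other than the item `j`. -/
noncomputable def plantedFactor (z : J → κ) (j : J) (i : κ) (b : Bool) (π : Ω) : ℝ :=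
  𝔼 β : J → Bool, P.factor i π fun j' => if j' = j then b else decide (z j' = i) && β j'

theorem plantedFactor_nonneg (z : J → κ) (j : J) (i : κ) (b : Bool) (π : Ω) :
    0 ≤ P.plantedFactor z j i b π :=
  expect_nonneg fun _ _ => P.factor_nonneg _ _ _

theorem plantedLaw_nonneg (z : J → κ) (j : J) (S : κ → Bool) (π : Ω) :
    0 ≤ P.plantedLaw z j S π :=
  expect_nonneg fun _ _ => P.law_nonneg _ _

theorem sum_plantedLaw (z : J → κ) (j : J) (S : κ → Bool) : ∑ π, P.plantedLaw z j S π = 1 := by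
  simp only [plantedLaw]
  rw [← expect_sum_comm]
  simp [P.sum_law]

/-- Once the owners `z` are fixed, the players' backgrounds are independent, so the product form
survives averaging over them. -/
theorem plantedLaw_eq (z : J → κ) (j : J) (S : κ → Bool) (π : Ω) :
    P.plantedLaw z j S π = P.base π * ∏ i, P.plantedFactor z j i (S i) π := by
  simp only [plantedLaw, law, plantedFactor]
  rw [← mul_expect, prod_expect]
  rfl

theorem expect_plantedLaw (z : J → κ) (j : J) (T : Finset κ) (π : Ω) :
    𝔼 S : κ → Bool, P.plantedLaw z j (fun i => S i && decide (i ∈ T)) π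
      = P.base π * ∏ i, 𝔼 b, P.plantedFactor z j i (b && decide (i ∈ T)) π := by
  simp only [plantedLaw_eq]
  rw [← mul_expect, prod_expect]

/-- How much the transcript tells about player `i` holding the item `j`. -/
noncomputable def leak (z : J → κ) (j : J) (i : κ) : ℝ :=
  klSum (P.plantedLaw z j fun _ => false)
    (fun π => 𝔼 b, P.plantedLaw z j (fun i' => b && decide (i' = i)) π)

theorem leak_nonneg (z : J → κ) (j : J) (i : κ) : 0 ≤ P.leak z j i := by
  refine klSum_nonneg (P.plantedLaw_nonneg z j _)
    (fun π => expect_nonneg fun b _ => P.plantedLaw_nonneg z j _ π) (fun π hπ => ?_) ?_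
  · rw [expect_bool] at hπ
    simp only [Bool.false_and] at hπ
    have h1 := P.plantedLaw_nonneg z j (fun _ => false) π
    have h2 := P.plantedLaw_nonneg z j (fun i' => true && decide (i' = i)) π
    linarith
  · rw [sum_plantedLaw, ← expect_sum_comm]
    simp [sum_plantedLaw]

/-- Only the factor of player `i` changes, so the likelihood ratio of the two laws is the ratio of
its averaged factor to its factor at `false`. The identity is cross-multiplied because factors may
vanish. -/
theorem expect_plantedLaw_single (z : J → κ) (j : J) (i : κ) (π : Ω) :
    P.plantedFactor z j i false π *
        𝔼 b, P.plantedLaw z j (fun i' => b && decide (i' = i)) π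
      = P.plantedLaw z j (fun _ => false) π * 𝔼 b, P.plantedFactor z j i b π := by
  rw [mul_expect, mul_expect]
  refine expect_congr rfl fun b _ => ?_
  rw [plantedLaw_eq, plantedLaw_eq, ← mul_prod_erase univ _ (mem_univ i),
    ← mul_prod_erase univ (fun i => P.plantedFactor z j i false π) (mem_univ i)]
  have : ∏ i' ∈ univ.erase i, P.plantedFactor z j i' (b && decide (i' = i)) π
      = ∏ i' ∈ univ.erase i, P.plantedFactor z j i' false π :=
    prod_congr rfl fun i' hi' => by simp [ne_of_mem_erase hi']
  rw [this]
  simp only [decide_true, Bool.and_true]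
  ring

/-- Planting the item `j` with a random half of the players of `T` changes probabilities little if
the transcript leaks little. -/
theorem mul_sum_plantedLaw_le (z : J → κ) (j : J) (T : Finset κ) {t : ℝ} (ht : 0 ≤ t) {e : Ω → ℝ}
    (h0 : ∀ π, 0 ≤ e π) (h1 : ∀ π, e π ≤ 1) :
    t * ∑ π, P.plantedLaw z j (fun _ => false) π * e π
      ≤ ∑ i, P.leak z j i + (Real.exp t - 1) *
        ∑ π, (𝔼 S : κ → Bool, P.plantedLaw z j (fun i => S i && decide (i ∈ T)) π) * e π := by
  set p : Ω → ℝ := P.plantedLaw z j fun _ => false with hp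
  set q : Ω → ℝ := fun π => 𝔼 S : κ → Bool, P.plantedLaw z j (fun i => S i && decide (i ∈ T)) π
    with hq
  set R : κ → Ω → ℝ := fun i π => 𝔼 b, P.plantedLaw z j (fun i' => b && decide (i' = i)) π with hR
  have hp0 : ∀ π, 0 ≤ p π := P.plantedLaw_nonneg z j _
  have hq0 : ∀ π, 0 ≤ q π := fun π => expect_nonneg fun _ _ => P.plantedLaw_nonneg z j _ π
  have hexp : ∀ π, 0 ≤ 1 + (Real.exp t - 1) * e π := fun π =>
    add_nonneg zero_le_one (mul_nonneg (by linarith [Real.add_one_le_exp t]) (h0 π))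
  have hpt : ∀ π, t * (p π * e π) ≤ ∑ i ∈ T, p π * Real.log (p π / R i π)
      + q π * (1 + (Real.exp t - 1) * e π) - p π := by
    intro π
    rcases (hp0 π).eq_or_lt with h | h
    · rw [← h]
      simpa using mul_nonneg (hq0 π) (hexp π)
    have hne : ∀ i, P.plantedFactor z j i false π ≠ 0 := by
      have := h.ne'
      rw [hp, plantedLaw_eq] at this
      exact fun i => prod_ne_zero_iff.1 (right_ne_zero_of_mul this) i (mem_univ i)
    have hpos : ∀ i, 0 < P.plantedFactor z j i false π := fun i =>
      (P.plantedFactor_nonneg z j i false π).lt_of_ne (hne i).symm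
    have hmean : ∀ i, 0 < 𝔼 b, P.plantedFactor z j i b π := fun i =>
      expect_pos' (fun b _ => P.plantedFactor_nonneg z j i b π) ⟨false, mem_univ _, hpos i⟩
    have hRpos : ∀ i, 0 < R i π := fun i =>
      expect_pos' (fun b _ => P.plantedLaw_nonneg z j _ π) ⟨false, mem_univ _, by simpa [hp] using h⟩
    have hratio : ∀ i, R i π / p π
        = (𝔼 b, P.plantedFactor z j i b π) / P.plantedFactor z j i false π := by
      intro i
      rw [div_eq_div_iff h.ne' (hne i), mul_comm, P.expect_plantedLaw_single, mul_comm]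
    set Y := ∏ i ∈ T, R i π / p π with hY
    have hYpos : 0 < Y := prod_pos fun i _ => div_pos (hRpos i) h
    -- The product form at work: planting with a random half of `T` multiplies the likelihood by the
    -- single-player ratios.
    have hqY : q π = p π * Y := by
      rw [hq, hp, hY]
      simp only
      rw [expect_plantedLaw, plantedLaw_eq, mul_assoc, ← Finset.prod_ite_mem_eq T, ← prod_mul_distrib]
      congr 1
      refine prod_congr rfl fun i _ => ?_
      by_cases hi : i ∈ T
      · have := hratio i
        simp only [hi, if_true, decide_true, Bool.and_true]
        rw [this]
        field_simp [hne i]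
      · simp [hi]
    have hlog : ∑ i ∈ T, p π * Real.log (p π / R i π) = - (p π * Real.log Y) := by
      rw [hY, Real.log_prod fun i _ => (div_pos (hRpos i) h).ne', mul_sum, ← sum_neg_distrib]
      refine sum_congr rfl fun i _ => ?_
      rw [← inv_div, Real.log_inv]
      ring
    -- Pointwise Donsker–Varadhan inequality for the test function `t * e`; convexity then makes
    -- `exp (t * e)` linear in `e`.
    have hle := Real.log_le_sub_one_of_pos (mul_pos hYpos (Real.exp_pos (t * e π)))
    rw [Real.log_mul hYpos.ne' (Real.exp_pos _).ne', Real.log_exp] at hle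
    have h2 := mul_le_mul_of_nonneg_left hle h.le
    have h3 := mul_le_mul_of_nonneg_left (exp_mul_le (t := t) (h0 π) (h1 π)) (hq0 π)
    rw [hlog]
    rw [hqY] at h3 ⊢
    linarith
  have hleak : ∑ π, ∑ i ∈ T, p π * Real.log (p π / R i π) ≤ ∑ i, P.leak z j i := by
    rw [sum_comm]
    exact sum_le_univ_sum_of_nonneg fun i => P.leak_nonneg z j i
  have hsp : ∑ π, p π = 1 := P.sum_plantedLaw z j _
  have hsq : ∑ π, q π = 1 := by
    rw [hq, ← expect_sum_comm]
    simp [sum_plantedLaw]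
  calc t * ∑ π, p π * e π = ∑ π, t * (p π * e π) := mul_sum _ _ _
    _ ≤ ∑ π, (∑ i ∈ T, p π * Real.log (p π / R i π)
        + q π * (1 + (Real.exp t - 1) * e π) - p π) := sum_le_sum fun π _ => hpt π
    _ = ∑ π, ∑ i ∈ T, p π * Real.log (p π / R i π) + (∑ π, q π - ∑ π, p π)
        + (Real.exp t - 1) * ∑ π, q π * e π := by
      rw [mul_sum, ← sum_sub_distrib, ← sum_add_distrib, ← sum_add_distrib]
      exact sum_congr rfl fun π _ => by ring
    _ ≤ _ := by
      rw [hsp, hsq]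
      linarith

theorem sum_leak_owner_le [Nonempty Ω] (z : J → κ) :
    ∑ j, P.leak z j (z j) ≤ 2 * Real.log (Fintype.card Ω) := by
  -- The channel takes a bit for every pair, but reads only the owners' bits. Setting the bit `(z j,
  -- j)` amounts to planting `j` with its owner or with nobody.
  set W : (κ × J → Bool) → Ω → ℝ := fun B => P.law fun i j' => decide (z j' = i) && B (i, j')
    with hW
  have hcond : ∀ j b π, condLaw W (z j, j) b π
      = P.plantedLaw z j (fun i' => b && decide (i' = z j)) π := by
    intro j b π
    refine Fintype.expect_equiv (Equiv.curry κ J Bool) _ _ fun B => ?_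
    simp only [hW]
    congr 1
    ext i j'
    rw [plantedInput]
    by_cases hj : j' = j
    · subst hj
      by_cases hi : i = z j'
      · simp [hi]
      · simp [hi, Ne.symm hi]
    · simp [hj]
  have h := sum_klSum_condLaw_false_le (W := W) (fun B π => P.law_nonneg _ _)
    (fun B => P.sum_law _) (univ.image fun j => (z j, j))
  rw [sum_image fun a _ b _ hab => (Prod.ext_iff.1 hab).2] at h
  convert h using 2 with j
  rw [leak]
  congr 1
  · ext π
    simp [hcond]
  · ext π
    rw [← expect_condLaw W (z j, j) π]
    simp [hcond]

theorem leak_update (z : J → κ) (j : J) (i i' : κ) :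
    P.leak (Function.update z j i) j i' = P.leak z j i' := by
  have h : P.plantedLaw (Function.update z j i) j = P.plantedLaw z j := by
    ext S π
    simp only [plantedLaw, plantedInput_update]
  simp only [leak, h]

theorem expect_leak_le [Nonempty Ω] [Nonempty κ] [Nonempty J] :
    𝔼 z, 𝔼 j, ∑ i, P.leak z j i
      ≤ 2 * Fintype.card κ * Real.log (Fintype.card Ω) / Fintype.card J := by
  have h1 : ∀ j, 𝔼 z, ∑ i, P.leak z j i = Fintype.card κ * 𝔼 z, P.leak z j (z j) := by
    intro j
    -- After resampling `z j`, which the leak ignores, the owner is a uniform player, so the owner's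
    -- leak is on average a `1 / card κ` share of the total.
    rw [← expect_expect_update j fun z => P.leak z j (z j), mul_expect]
    refine expect_congr rfl fun z _ => ?_
    simp only [Function.update_self, leak_update]
    rw [Fintype.card_mul_expect]
  calc 𝔼 z, 𝔼 j, ∑ i, P.leak z j i = 𝔼 j, 𝔼 z, ∑ i, P.leak z j i := expect_comm _ _ _
    _ = Fintype.card κ * (𝔼 z, ∑ j, P.leak z j (z j)) / Fintype.card J := by
      simp only [h1]
      rw [← mul_expect, Fintype.expect_eq_sum_div_card, expect_sum_comm, mul_div_assoc]
    _ ≤ Fintype.card κ * (2 * Real.log (Fintype.card Ω)) / Fintype.card J := by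
      gcongr
      exact expect_le univ_nonempty fun z _ => P.sum_leak_owner_le z
    _ = _ := by ring

/-- The probability of an event that depends on the transcript, here averaged against a function
`e` with values in `[0, 1]`. -/
noncomputable def prob (X : κ → J → Bool) (e : Ω → ℝ) : ℝ := ∑ π, P.law X π * e π

theorem sum_plantedLaw_mul (z : J → κ) (j : J) (S : κ → Bool) (e : Ω → ℝ) :
    ∑ π, P.plantedLaw z j S π * e π = 𝔼 B, P.prob (plantedInput z j S B) e := by
  simp only [plantedLaw, prob, expect_sum_comm, expect_mul]

theorem mul_expect_prob_le [Nonempty Ω] [Nonempty κ] [Nonempty J] (T : Finset κ) {t : ℝ}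
    (ht : 0 ≤ t) {e : Ω → ℝ} (h0 : ∀ π, 0 ≤ e π) (h1 : ∀ π, e π ≤ 1) :
    t * 𝔼 z, 𝔼 j, 𝔼 B, P.prob (plantedInput z j (fun _ => false) B) e
      ≤ 2 * Fintype.card κ * Real.log (Fintype.card Ω) / Fintype.card J + (Real.exp t - 1) *
        𝔼 z, 𝔼 j, 𝔼 S : κ → Bool, 𝔼 B,
          P.prob (plantedInput z j (fun i => S i && decide (i ∈ T)) B) e := by
  have h : ∀ z j, t * 𝔼 B, P.prob (plantedInput z j (fun _ => false) B) e
      ≤ ∑ i, P.leak z j i + (Real.exp t - 1) * 𝔼 S : κ → Bool, 𝔼 B,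
          P.prob (plantedInput z j (fun i => S i && decide (i ∈ T)) B) e := by
    intro z j
    have := P.mul_sum_plantedLaw_le z j T ht h0 h1
    simp only [expect_mul, sum_plantedLaw_mul] at this
    rw [← expect_sum_comm] at this
    simpa only [sum_plantedLaw_mul] using this
  calc _ = 𝔼 z, 𝔼 j, t * 𝔼 B, P.prob (plantedInput z j (fun _ => false) B) e := by
        simp only [mul_expect]
    _ ≤ 𝔼 z, 𝔼 j, (∑ i, P.leak z j i + (Real.exp t - 1) * 𝔼 S : κ → Bool, 𝔼 B,
          P.prob (plantedInput z j (fun i => S i && decide (i ∈ T)) B) e) :=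
        expect_le_expect fun z _ => expect_le_expect fun j _ => h z j
    _ ≤ _ := by
        simp only [expect_add_distrib]
        simp only [← mul_expect]
        gcongr
        exact P.expect_leak_le

end RectangleProtocol

end Protocol

/-! ### From streaming algorithms to transcripts -/

section Transcripts

theorem PMF.sum_toReal {M : Type*} [Fintype M] (p : PMF M) : ∑ s, (p s).toReal = 1 := by
  rw [← ENNReal.toReal_sum fun s _ => p.apply_ne_top s, ← tsum_fintype (L := .unconditional M),
    p.tsum_coe, ENNReal.toReal_one]

theorem PMF.toReal_bind_apply {M α : Type*} [Fintype M] (p : PMF M) (f : M → PMF α) (a : α) :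
    ((p.bind f) a).toReal = ∑ s, (p s).toReal * (f s a).toReal := by
  rw [PMF.bind_apply, tsum_fintype, ENNReal.toReal_sum fun s _ =>
    ENNReal.mul_ne_top (p.apply_ne_top s) ((f s).apply_ne_top a)]
  simp only [ENNReal.toReal_mul]

theorem PMF.toOuterMeasure_le_one {α : Type*} (p : PMF α) (E : Set α) : p.toOuterMeasure E ≤ 1 := by
  rw [PMF.toOuterMeasure_apply, ← p.tsum_coe]
  exact ENNReal.tsum_le_tsum fun a => Set.indicator_le_self _ _ a

variable {κ J M : Type} [Fintype κ] [Fintype M] [DecidableEq M]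

/-- The laws `μ X` are those of the last message of a number-in-hand protocol with `C`
transcripts. -/
def HasTranscripts (C : ℕ) (μ : (κ → J → Bool) → PMF M) : Prop :=
  ∃ (Ω : Type) (_ : Fintype Ω) (P : RectangleProtocol κ J Ω) (out : Ω → M),
    Fintype.card Ω = C ∧ ∀ X s, (μ X s).toReal = ∑ π, if out π = s then P.law X π else 0

namespace HasTranscripts

theorem const (p : PMF M) : HasTranscripts (Fintype.card M) fun _ : κ → J → Bool => p := by
  refine ⟨M, inferInstance, ⟨fun s => (p s).toReal, fun _ _ _ => 1,
    fun _ => ENNReal.toReal_nonneg, fun _ _ _ => zero_le_one, fun X => ?_⟩, id, rfl, fun X s => ?_⟩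
  · simp [p.sum_toReal]
  · simp [RectangleProtocol.law]

/-- A new message depends only on the last message and the speaker's input, so its probability is
absorbed into the speaker's factor and the product form persists. -/
theorem bind_player [DecidableEq κ] {C : ℕ} {μ : (κ → J → Bool) → PMF M} (h : HasTranscripts C μ)
    (i₀ : κ) (K : (J → Bool) → M → PMF M) :
    HasTranscripts (C * Fintype.card M) fun X => (μ X).bind (K (X i₀)) := by
  obtain ⟨Ω, _, P, out, hC, hμ⟩ := h
  have hlaw : ∀ (X : κ → J → Bool) (q : Ω × M), P.base q.1 * ∏ i, (P.factor i q.1 (X i) *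
      if i = i₀ then (K (X i) (out q.1) q.2).toReal else 1)
      = P.law X q.1 * (K (X i₀) (out q.1) q.2).toReal := by
    intro X q
    rw [prod_mul_distrib, prod_ite_eq' univ i₀ fun i => (K (X i) (out q.1) q.2).toReal]
    simp [RectangleProtocol.law, mul_assoc]
  refine ⟨Ω × M, inferInstance, ⟨fun q => P.base q.1, fun i q x => P.factor i q.1 x *
    if i = i₀ then (K x (out q.1) q.2).toReal else 1, fun q => P.base_nonneg q.1,
    fun i q x => mul_nonneg (P.factor_nonneg _ _ _) ?_, fun X => ?_⟩, Prod.snd, ?_, fun X s => ?_⟩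
  · split_ifs
    · exact ENNReal.toReal_nonneg
    · exact zero_le_one
  · simp only [hlaw]
    rw [Fintype.sum_prod_type]
    simp only [← mul_sum, PMF.sum_toReal, mul_one, P.sum_law]
  · rw [Fintype.card_prod, hC]
  · rw [PMF.toReal_bind_apply]
    simp only [RectangleProtocol.law] at hlaw ⊢
    simp only [hlaw]
    rw [Fintype.sum_prod_type]
    simp only [sum_ite_eq', mem_univ, if_true]
    simp only [hμ, sum_mul]
    rw [sum_comm]
    refine sum_congr rfl fun π _ => ?_
    simp [RectangleProtocol.law, ite_mul]

end HasTranscripts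

namespace StreamingAlgorithm

variable {n r S : ℕ} (A : StreamingAlgorithm n r S)

theorem readItems_append (ρ : A.Seed) (i : Fin r) (l₁ l₂ : List (Fin n)) (s : Memory S) :
    A.readItems ρ i (l₁ ++ l₂) s = (A.readItems ρ i l₁ s).bind (A.readItems ρ i l₂) := by
  induction l₁ generalizing s with
  | nil => simp [readItems]
  | cons a l ih => 
    simp only [List.cons_append, readItems, PMF.bind_bind]
    exact congrArg _ (funext ih)

theorem hasTranscripts_readItems [DecidableEq κ] {C : ℕ} {μ : (κ → J → Bool) → PMF (Memory S)}
    (h : HasTranscripts C μ) (items : (J → Bool) → List (Fin n)) (ρ : A.Seed) (i : Fin r)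
    (l : List κ) :
    HasTranscripts (C * (2 ^ S) ^ l.length) fun X =>
      (μ X).bind (A.readItems ρ i (l.flatMap fun a => items (X a))) := by
  induction l generalizing C μ with
  | nil => simpa [readItems] using h
  | cons a l ih =>
    have := ih (h.bind_player a fun x => A.readItems ρ i (items x))
    simp only [List.flatMap_cons, PMF.bind_bind, ← readItems_append] at this ⊢
    convert this using 1
    simp [pow_succ]
    ring

theorem hasTranscripts_finalMemory [DecidableEq κ] [Nonempty κ]
    (items : (J → Bool) → List (Fin n)) (ρ : A.Seed) (l : List κ) :
    HasTranscripts (2 ^ (S * (1 + (l.length + 1) * r))) fun X : κ → J → Bool =>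
      A.finalMemory ρ (l.flatMap fun a => items (X a)) := by
  have key : ∀ (L : List (Fin r)) (C : ℕ) (μ : (κ → J → Bool) → PMF (Memory S)),
      HasTranscripts C μ → HasTranscripts (C * (2 ^ (S * (l.length + 1))) ^ L.length) fun X =>
        L.foldl (fun ν i => ν.bind (A.runPass ρ (l.flatMap fun a => items (X a)) i)) (μ X) := by
    intro L
    induction L with
    | nil => intro C μ h; simpa using h
    | cons i L ih =>
      intro C μ h
      -- The end of a pass reads no input, so any player may speak it. It accounts for the `+ 1` in
      -- the messages per pass.
      have h2 := (A.hasTranscripts_readItems h items ρ i l).bind_player (Classical.arbitrary κ)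
        fun _ => A.endPass ρ i
      have h3 := ih _ _ h2
      simp only [List.foldl_cons, PMF.bind_bind] at h3 ⊢
      convert h3 using 1
      · simp [pow_succ, pow_mul]
        ring
      · rfl
  have h := key (List.finRange r) _ _ (HasTranscripts.const (κ := κ) (J := J) (A.init ρ))
  simp only [finalMemory]
  convert h using 1
  simp only [Fintype.card_pi, Fintype.card_bool, prod_const, card_univ, Fintype.card_fin,
    List.length_finRange]
  rw [← pow_mul, ← pow_add]
  ring_nf

/-- Probability that the output lies in `E` on the stream `σ`. -/
noncomputable def outputProb (σ : List (Fin n)) (E : Set ℝ) : ℝ :=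
  ((A.outputLaw σ).toOuterMeasure E).toReal

/-- Probability that the output lies in `E` on the stream `σ`, given the seed. -/
noncomputable def seedProb (ρ : A.Seed) (σ : List (Fin n)) (E : Set ℝ) : ℝ :=
  (((A.finalMemory ρ σ).bind (A.output ρ)).toOuterMeasure E).toReal

theorem hasSum_seedProb (σ : List (Fin n)) (E : Set ℝ) :
    HasSum (fun ρ => (A.seed ρ).toReal * A.seedProb ρ σ E) (A.outputProb σ E) := by
  have h : (A.outputLaw σ).toOuterMeasure E = ∑' ρ, A.seed ρ *
      ((A.finalMemory ρ σ).bind (A.output ρ)).toOuterMeasure E := by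
    rw [outputLaw, PMF.toOuterMeasure_bind_apply]
  have hne : (A.outputLaw σ).toOuterMeasure E ≠ ⊤ :=
    ((PMF.toOuterMeasure_le_one _ E).trans_lt ENNReal.one_lt_top).ne
  rw [h] at hne
  have := ENNReal.hasSum_toReal hne
  simp only [ENNReal.toReal_mul] at this
  rw [outputProb, h, ENNReal.tsum_toReal_eq fun ρ => ENNReal.ne_top_of_tsum_ne_top hne ρ]
  simpa only [seedProb, ENNReal.toReal_mul] using this

theorem seedProb_eq_sum (ρ : A.Seed) (σ : List (Fin n)) (E : Set ℝ) :
    A.seedProb ρ σ E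
      = ∑ s, (A.finalMemory ρ σ s).toReal * ((A.output ρ s).toOuterMeasure E).toReal := by
  rw [seedProb, PMF.toOuterMeasure_bind_apply, tsum_fintype, ENNReal.toReal_sum]
  · simp only [ENNReal.toReal_mul]
  · exact fun s _ => ENNReal.mul_ne_top (PMF.apply_ne_top _ _)
      ((PMF.toOuterMeasure_le_one _ E).trans_lt ENNReal.one_lt_top).ne

theorem hasSum_mul_expect {α β : Type*} [Fintype β] {w : α → ℝ} {f : β → α → ℝ} {a : β → ℝ}
    (h : ∀ b, HasSum (fun x => w x * f b x) (a b)) :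
    HasSum (fun x => w x * 𝔼 b, f b x) (𝔼 b, a b) := by
  simp only [Fintype.expect_eq_sum_div_card, mul_div_assoc', mul_sum]
  exact (hasSum_sum fun b _ => h b).div_const _

variable [DecidableEq κ] [Nonempty κ] [Fintype J] [DecidableEq J] [Nonempty J]

/-- A streaming algorithm with little memory is unlikely to notice that an item has been planted
with a random half of the players of `T`. -/
theorem mul_expect_outputProb_le (items : (J → Bool) → List (Fin n)) (l : List κ) (T : Finset κ)
    (E : Set ℝ) {t : ℝ} (ht : 0 ≤ t) :
    t * 𝔼 z, 𝔼 j, 𝔼 B,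
        A.outputProb (l.flatMap fun a => items (plantedInput z j (fun _ => false) B a)) E
      ≤ 2 * Fintype.card κ * ((S * (1 + (l.length + 1) * r) : ℕ) * Real.log 2) / Fintype.card J
        + (Real.exp t - 1) * 𝔼 z, 𝔼 j, 𝔼 U : κ → Bool, 𝔼 B, A.outputProb
          (l.flatMap fun a => items (plantedInput z j (fun i => U i && decide (i ∈ T)) B a)) E := by
  set K : ℝ := 2 * Fintype.card κ * ((S * (1 + (l.length + 1) * r) : ℕ) * Real.log 2)
    / Fintype.card J with hK
  -- The inequality is linear in the probabilities, so it is proved for each seed and averaged; this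
  -- is why the random string costs nothing.
  have hseed : ∀ ρ, t * 𝔼 z, 𝔼 j, 𝔼 B,
        A.seedProb ρ (l.flatMap fun a => items (plantedInput z j (fun _ => false) B a)) E
      ≤ K + (Real.exp t - 1) * 𝔼 z, 𝔼 j, 𝔼 U : κ → Bool, 𝔼 B, A.seedProb ρ
          (l.flatMap fun a => items (plantedInput z j (fun i => U i && decide (i ∈ T)) B a)) E := by
    intro ρ
    obtain ⟨Ω, _, P, out, hC, hμ⟩ := A.hasTranscripts_finalMemory (J := J) items ρ l
    have : Nonempty Ω := Fintype.card_pos_iff.1 (by rw [hC]; positivity)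
    set e : Ω → ℝ := fun π => ((A.output ρ (out π)).toOuterMeasure E).toReal with he
    have hprob : ∀ X : κ → J → Bool,
        A.seedProb ρ (l.flatMap fun a => items (X a)) E = P.prob X e := by
      intro X
      rw [seedProb_eq_sum]
      simp only [hμ, sum_mul, ite_mul, zero_mul]
      rw [sum_comm]
      simp [RectangleProtocol.prob, he]
    have h := P.mul_expect_prob_le T ht (e := e) (fun π => ENNReal.toReal_nonneg) fun π =>
      ENNReal.toReal_le_of_le_ofReal zero_le_one (by simpa using PMF.toOuterMeasure_le_one _ E)
    rw [hC] at h
    push_cast at h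
    rw [Real.log_pow] at h
    simpa only [hprob] using h
  have h0 := (hasSum_mul_expect fun z => hasSum_mul_expect fun j => hasSum_mul_expect fun B =>
    A.hasSum_seedProb (l.flatMap fun a =>
      items (plantedInput z j (fun _ : κ => false) B a)) E).mul_left t
  have h1 := (hasSum_mul_expect fun z => hasSum_mul_expect fun j => hasSum_mul_expect
    fun U : κ → Bool => hasSum_mul_expect fun B => A.hasSum_seedProb (l.flatMap fun a =>
      items (plantedInput z j (fun i => U i && decide (i ∈ T)) B a)) E).mul_left (Real.exp t - 1)
  have hs : HasSum (fun ρ => (A.seed ρ).toReal) 1 := by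
    have := ENNReal.hasSum_toReal (f := A.seed) (by simp [A.seed.tsum_coe])
    rwa [← ENNReal.tsum_toReal_eq fun ρ => A.seed.apply_ne_top ρ, A.seed.tsum_coe,
      ENNReal.toReal_one] at this
  have h2 := (hs.mul_right K).add h1
  rw [one_mul] at h2
  refine hasSum_le (fun ρ => ?_) h0 h2
  have := mul_le_mul_of_nonneg_left (hseed ρ) (ENNReal.toReal_nonneg (a := A.seed ρ))
  linarith

end StreamingAlgorithm

end Transcripts

/-! ### Streams with one planted item and their moments -/

section HardStreams

variable {N n k : ℕ}

/-- The first `N` items that are marked in `x`, in increasing order. -/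
def markedItems (hN : N ≤ n) (x : Fin N → Bool) : List (Fin n) :=
  ((List.finRange N).filter x).map (Fin.castLE hN)

theorem count_markedItems (hN : N ≤ n) (x : Fin N → Bool) (v : Fin n) :
    (markedItems hN x).count v = if ∃ j, x j = true ∧ Fin.castLE hN j = v then 1 else 0 := by
  have h : (markedItems hN x).Nodup :=
    ((List.nodup_finRange N).filter _).map (Fin.castLE_injective hN)
  rw [h.count]
  simp [markedItems]

theorem length_markedItems (hN : N ≤ n) (x : Fin N → Bool) :
    (markedItems hN x).length = ∑ j, if x j = true then 1 else 0 := by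
  rw [markedItems, List.length_map, ← List.toFinset_card_of_nodup ((List.nodup_finRange N).filter _),
    sum_boole, Nat.cast_id]
  congr 1
  ext j
  simp

/-- The stream in which every player in turn appends the items it holds. -/
def playerStream (hN : N ≤ n) (X : Fin k → Fin N → Bool) : List (Fin n) :=
  (List.finRange k).flatMap fun a => markedItems hN (X a)

theorem count_playerStream (hN : N ≤ n) (X : Fin k → Fin N → Bool) (v : Fin n) :
    (playerStream hN X).count v
      = ∑ a, if ∃ j, X a j = true ∧ Fin.castLE hN j = v then 1 else 0 := by
  rw [playerStream, List.count_flatMap, Fin.sum_univ_def]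
  congr 2
  funext a
  simp [count_markedItems]

theorem length_playerStream (hN : N ≤ n) (X : Fin k → Fin N → Bool) :
    (playerStream hN X).length = ∑ j, ∑ a, if X a j = true then 1 else 0 := by
  rw [playerStream, List.length_flatMap, ← Fin.sum_univ_def, sum_comm]
  simp only [length_markedItems]

variable (z : Fin N → Fin k) (j : Fin N) (U : Fin k → Bool) (B : Fin k → Fin N → Bool)

theorem count_planted (hN : N ≤ n) :
    (playerStream hN (plantedInput z j U B)).count (Fin.castLE hN j)
      = #{a | U a = true} := by
  rw [count_playerStream, card_filter]
  refine sum_congr rfl fun a _ => ?_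
  simp [plantedInput]

theorem count_planted_le_one (hN : N ≤ n) {v : Fin n} (hv : v ≠ Fin.castLE hN j) :
    (playerStream hN (plantedInput z j U B)).count v ≤ 1 := by
  rw [count_playerStream, sum_boole, Nat.cast_id, card_le_one]
  intro a ha b hb
  simp only [mem_filter, mem_univ, true_and] at ha hb
  obtain ⟨j₁, h₁, rfl⟩ := ha
  obtain ⟨j₂, h₂, h₃⟩ := hb
  obtain rfl := Fin.castLE_injective hN h₃
  have hj : j₂ ≠ j := fun h => hv (by rw [h])
  simp only [plantedInput, hj, if_false, Bool.and_eq_true, decide_eq_true_eq] at h₁ h₂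
  rw [← h₁.1, ← h₂.1]

theorem length_planted_le (hN : N ≤ n) :
    (playerStream hN (plantedInput z j U B)).length ≤ N + k := by
  rw [length_playerStream]
  have h : ∀ j', (∑ a, if plantedInput z j U B a j' = true then 1 else 0)
      ≤ 1 + if j' = j then k else 0 := by
    intro j'
    by_cases hj : j' = j
    · rw [if_pos hj]
      calc _ ≤ ∑ _a : Fin k, 1 := sum_le_sum fun a _ => by split_ifs <;> simp
        _ ≤ 1 + k := by simp
    · rw [if_neg hj, sum_boole, Nat.cast_id, add_zero, card_le_one]
      intro a ha b hb
      simp only [plantedInput, hj, if_false, Bool.and_eq_true, decide_eq_true_eq, mem_filter,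
        mem_univ, true_and] at ha hb
      rw [← ha.1, ← hb.1]
  refine (sum_le_sum fun j' _ => h j').trans ?_
  simp [sum_add_distrib]

theorem le_frequencyMoment_planted (hN : N ≤ n) (p : ℝ) :
    (#{a | U a = true} : ℝ) ^ p ≤ frequencyMoment p (playerStream hN (plantedInput z j U B)) := by
  rw [← count_planted z j U B hN, frequencyMoment]
  exact single_le_sum (f := fun v => ((playerStream hN (plantedInput z j U B)).count v : ℝ) ^ p)
    (fun v _ => Real.rpow_nonneg (Nat.cast_nonneg _) _) (mem_univ _)

theorem frequencyMoment_planted_le (hN : N ≤ n) {p : ℝ} (hp : 0 ≤ p) :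
    frequencyMoment p (playerStream hN (plantedInput z j U B))
      ≤ (#{a | U a = true} : ℝ) ^ p + n := by
  calc frequencyMoment p (playerStream hN (plantedInput z j U B))
      ≤ ∑ v, ((if v = Fin.castLE hN j then (#{a | U a = true} : ℝ) ^ p else 0) + 1) := by
        refine sum_le_sum fun v _ => ?_
        split_ifs with hv
        · rw [hv, count_planted]
          linarith
        · rw [zero_add]
          refine Real.rpow_le_one (Nat.cast_nonneg _) ?_ hp
          exact_mod_cast count_planted_le_one z j U B hN hv
    _ = _ := by simp [sum_add_distrib]

end HardStreams

/-! ### Tail of a random half, and disjoint events -/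

section Probability

/-- A random half of `T` has at least `#T / 16` elements, up to an exponentially small
probability. -/
theorem expect_card_lt_le {κ : Type*} [Fintype κ] [DecidableEq κ] (T : Finset κ) :
    𝔼 U : κ → Bool, (if 16 * #{i | (U i && decide (i ∈ T)) = true} < #T then (1 : ℝ) else 0)
      ≤ Real.exp (-(#T / 4)) := by
  -- Chernoff bound with parameter 4: the threshold costs `exp (#T / 4)`, and by `hhalf` each player
  -- of `T` gains a factor `exp (-1/2)`.
  have hpt : ∀ U : κ → Bool,
      (if 16 * #{i | (U i && decide (i ∈ T)) = true} < #T then (1 : ℝ) else 0)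
      ≤ Real.exp (#T / 4) * ∏ i, if (U i && decide (i ∈ T)) = true then Real.exp (-4) else 1 := by
    intro U
    rw [prod_ite, prod_const, prod_const_one, mul_one, ← Real.exp_nat_mul, ← Real.exp_add]
    split_ifs with h
    · refine Real.one_le_exp ?_
      have : (16 * #{i | (U i && decide (i ∈ T)) = true} : ℝ) < #T := by exact_mod_cast h
      linarith
    · exact (Real.exp_pos _).le
  have hhalf : (Real.exp (-4) + 1) / 2 ≤ Real.exp (-(1 / 2)) := by
    have h1 : Real.exp 1 < 2.7182818286 := Real.exp_one_lt_d9
    have h2 : (2 : ℝ) ≤ Real.exp 1 := by linarith [Real.add_one_le_exp (1 : ℝ)]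
    have h3 : Real.exp (1 / 2) ^ 2 = Real.exp 1 := by rw [← Real.exp_nat_mul]; norm_num
    have h4 : Real.exp 4 = Real.exp 1 ^ 4 := by rw [← Real.exp_nat_mul]; norm_num
    have h5 : (16 : ℝ) ≤ Real.exp 4 := by
      rw [h4]
      calc (16 : ℝ) = 2 ^ 4 := by norm_num
        _ ≤ _ := by gcongr
    have h6 : Real.exp (-4) ≤ 1 / 16 := by
      rw [Real.exp_neg, inv_eq_one_div]
      exact one_div_le_one_div_of_le (by norm_num) h5
    have h7 : Real.exp (1 / 2) ≤ 32 / 17 := by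
      refine (pow_le_pow_iff_left₀ (Real.exp_pos _).le (by norm_num) two_ne_zero).1 ?_
      rw [h3]
      norm_num
      linarith
    have h8 : 17 / 32 ≤ Real.exp (-(1 / 2)) := by
      rw [Real.exp_neg, ← inv_div]
      exact inv_anti₀ (Real.exp_pos _) h7
    linarith
  calc _ ≤ 𝔼 U : κ → Bool, Real.exp (#T / 4) *
        ∏ i, (if (U i && decide (i ∈ T)) = true then Real.exp (-4) else 1) :=
        expect_le_expect fun U _ => hpt U
    _ = Real.exp (#T / 4) * ∏ i, if i ∈ T then (Real.exp (-4) + 1) / 2 else 1 := by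
        rw [← mul_expect, ← prod_expect fun (i : κ) (b : Bool) =>
          if (b && decide (i ∈ T)) = true then Real.exp (-4) else 1]
        congr 1
        refine prod_congr rfl fun i _ => ?_
        rw [expect_bool]
        by_cases hi : i ∈ T <;> simp [hi]
    _ = Real.exp (#T / 4) * ((Real.exp (-4) + 1) / 2) ^ #T := by
        rw [prod_ite_mem, univ_inter, prod_const]
    _ ≤ Real.exp (#T / 4) * Real.exp (-(1 / 2)) ^ #T := by gcongr
    _ = _ := by
        rw [← Real.exp_nat_mul, ← Real.exp_add]
        ring_nf

/-- Every point lies in at most one of the `m + 1` sets, hence in at least `m` complements. -/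
theorem PMF.le_sum_toOuterMeasure_compl {α : Type*} (q : PMF α) {m : ℕ} {E : Fin (m + 1) → Set α}
    (hE : Pairwise fun i j => Disjoint (E i) (E j)) :
    (m : ENNReal) ≤ ∑ i, q.toOuterMeasure (E i)ᶜ := by
  classical
  have hcard : ∀ x, m ≤ #{i | x ∈ (E i)ᶜ} := by
    intro x
    have h1 : #{i | x ∈ E i} ≤ 1 := by
      refine card_le_one.2 fun i hi j hj => by_contra fun hij => ?_
      exact Set.disjoint_left.1 (hE hij) (mem_filter.1 hi).2 (mem_filter.1 hj).2
    have h2 := card_filter_add_card_filter_not (s := (univ : Finset (Fin (m + 1))))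
      fun i => x ∈ E i
    simp only [card_univ, Fintype.card_fin] at h2
    simp only [Set.mem_compl_iff]
    omega
  calc (m : ENNReal) = ∑' x, q x * m := by rw [ENNReal.tsum_mul_right, q.tsum_coe, one_mul]
    _ ≤ ∑' x, ∑ i, (E i)ᶜ.indicator q x := by
        refine ENNReal.tsum_le_tsum fun x => ?_
        simp only [Set.indicator_apply]
        rw [← sum_filter, sum_const, nsmul_eq_mul, mul_comm]
        gcongr
        exact hcard x
    _ = ∑ i, q.toOuterMeasure (E i)ᶜ := by
        rw [Summable.tsum_finsetSum fun _ _ => ENNReal.summable]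
        simp only [PMF.toOuterMeasure_apply]

theorem StreamingAlgorithm.le_sum_outputProb_compl {n r S : ℕ} (A : StreamingAlgorithm n r S)
    (σ : List (Fin n)) {m : ℕ} {E : Fin (m + 1) → Set ℝ}
    (hE : Pairwise fun i j => Disjoint (E i) (E j)) : (m : ℝ) ≤ ∑ i, A.outputProb σ (E i)ᶜ := by
  have hne : ∀ i, (A.outputLaw σ).toOuterMeasure (E i)ᶜ ≠ ⊤ := fun i =>
    ((PMF.toOuterMeasure_le_one _ _).trans_lt ENNReal.one_lt_top).ne
  have h := ENNReal.toReal_mono (ENNReal.sum_ne_top.2 fun i _ => hne i)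
    ((A.outputLaw σ).le_sum_toOuterMeasure_compl hE)
  rwa [ENNReal.toReal_sum fun i _ => hne i, ENNReal.toReal_natCast] at h

end Probability

/-! ### Separated scales and the memory–error trade-off -/

section Scales

/-- The estimates that are acceptable when one item occurs between `t / 16` and `t` times. -/
def acceptable (p ε t : ℝ) : Set ℝ :=
  Set.Icc ((1 - ε) * (t / 16) ^ p) ((1 + ε) * (2 * t ^ p))

/-- The upper end for `t` is at most `4 * t ^ p`, while the lower end for `t'` is at least `(1 - ε)
* (D / 16) * t ^ p`, because `(D / 16) ^ p ≥ D / 16`. This is where the constant 64 comes from. -/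
theorem disjoint_acceptable {p ε D t t' : ℝ} (hp : 1 ≤ p) (hε : ε < 1) (hD : 64 < (1 - ε) * D)
    (hD16 : 16 ≤ D) (ht : 0 < t) (h : D * t ≤ t') :
    Disjoint (acceptable p ε t) (acceptable p ε t') := by
  have htp : 0 < t ^ p := Real.rpow_pos_of_pos ht p
  have h1 : D / 16 * t ^ p ≤ (t' / 16) ^ p := by
    calc D / 16 * t ^ p ≤ (D / 16) ^ p * t ^ p := by
          gcongr
          exact Real.self_le_rpow_of_one_le (by linarith) hp
      _ = (D / 16 * t) ^ p := (Real.mul_rpow (by linarith) ht.le).symm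
      _ ≤ _ := Real.rpow_le_rpow (by positivity) (by linarith) (by linarith)
  have h2 : (1 + ε) * (2 * t ^ p) < (1 - ε) * (t' / 16) ^ p := by
    calc (1 + ε) * (2 * t ^ p) ≤ 4 * t ^ p := by nlinarith
      _ < (1 - ε) * D / 16 * t ^ p := by gcongr; linarith
      _ = (1 - ε) * (D / 16 * t ^ p) := by ring
      _ ≤ _ := mul_le_mul_of_nonneg_left h1 (by linarith)
  rw [Set.disjoint_left]
  rintro x ⟨_, hx⟩ ⟨hx', _⟩
  linarith

variable {n r S : ℕ} {A : StreamingAlgorithm n r S}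

theorem outputProb_le_of_frequencyMoment {L : ℕ} {p ε δ a b : ℝ} (hA : A.EstimatesMoment L p ε δ)
    (hδ : 0 ≤ δ) (hε₀ : 0 ≤ ε) (hε₁ : ε ≤ 1) {σ : List (Fin n)} (hσ : σ.length ≤ L)
    (ha : a ≤ frequencyMoment p σ) (hb : frequencyMoment p σ ≤ b) :
    A.outputProb σ (Set.Icc ((1 - ε) * a) ((1 + ε) * b))ᶜ ≤ δ := by
  refine ENNReal.toReal_le_of_le_ofReal hδ (le_trans (MeasureTheory.measure_mono ?_) (hA σ hσ))
  intro x hx hx'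
  refine hx ⟨?_, ?_⟩
  · exact (mul_le_mul_of_nonneg_left ha (by linarith)).trans hx'.1
  · exact hx'.2.trans (mul_le_mul_of_nonneg_left hb (by linarith))

/-- An error has two causes: the algorithm fails, or the random half is smaller than `#T / 16`.
Otherwise the moment lies between `(#T / 16) ^ p` and `2 * #T ^ p`, the background being covered by
`n ≤ #T ^ p`. -/
theorem expect_outputProb_planted_le {N k L : ℕ} [NeZero k] {p ε δ : ℝ}
    (hA : A.EstimatesMoment L p ε δ) (hδ : 0 ≤ δ) (hε₀ : 0 ≤ ε) (hε₁ : ε ≤ 1) (hp : 0 ≤ p)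
    (hN : N ≤ n) (hL : N + k ≤ L) (T : Finset (Fin k)) (hT : (n : ℝ) ≤ (#T : ℝ) ^ p)
    (z : Fin N → Fin k) (j : Fin N) :
    𝔼 U : Fin k → Bool, 𝔼 B, A.outputProb (playerStream hN
        (plantedInput z j (fun i => U i && decide (i ∈ T)) B)) (acceptable p ε #T)ᶜ
      ≤ δ + Real.exp (-(#T / 4)) := by
  have h : ∀ (U : Fin k → Bool) B, A.outputProb (playerStream hN
      (plantedInput z j (fun i => U i && decide (i ∈ T)) B)) (acceptable p ε #T)ᶜ
      ≤ δ + if 16 * #{i | (U i && decide (i ∈ T)) = true} < #T then (1 : ℝ) else 0 := by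
    intro U B
    split_ifs with hU
    · refine le_add_of_nonneg_of_le hδ (ENNReal.toReal_le_of_le_ofReal zero_le_one ?_)
      simpa using PMF.toOuterMeasure_le_one _ _
    · rw [add_zero]
      refine outputProb_le_of_frequencyMoment hA hδ hε₀ hε₁ ((length_planted_le ..).trans hL)
        (le_trans ?_ (le_frequencyMoment_planted ..))
        ((frequencyMoment_planted_le z j _ B hN hp).trans ?_)
      · refine Real.rpow_le_rpow (by positivity) ?_ hp
        have : (#T : ℝ) ≤ 16 * #{i | (U i && decide (i ∈ T)) = true} := by
          exact_mod_cast not_lt.1 hU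
        linarith
      · have : (#{i | (U i && decide (i ∈ T)) = true} : ℝ) ^ p ≤ (#T : ℝ) ^ p := by
          refine Real.rpow_le_rpow (by positivity) ?_ hp
          refine Nat.cast_le.2 (card_le_card fun i hi => ?_)
          simp only [mem_filter, mem_univ, true_and, Bool.and_eq_true, decide_eq_true_eq] at hi
          exact hi.2
        linarith
  calc _ ≤ 𝔼 U : Fin k → Bool, 𝔼 _B : Fin k → Fin N → Bool,
        (δ + if 16 * #{i | (U i && decide (i ∈ T)) = true} < #T then (1 : ℝ) else 0) :=
        expect_le_expect fun U _ => expect_le_expect fun B _ => h U B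
    _ = δ + 𝔼 U : Fin k → Bool,
        (if 16 * #{i | (U i && decide (i ∈ T)) = true} < #T then (1 : ℝ) else 0) := by
        simp only [Fintype.expect_const, expect_add_distrib]
    _ ≤ _ := by
        gcongr
        exact expect_card_lt_le T

/-- Trade-off between memory and error for planted items at `m + 1` scales. -/
theorem memory_error_tradeoff {N s m D L : ℕ} {p ε δ t : ℝ} (hA : A.EstimatesMoment L p ε δ)
    (hδ : 0 ≤ δ) (hε₀ : 0 ≤ ε) (hε₁ : ε < 1) (hp : 1 ≤ p) (hD : 64 < (1 - ε) * D)
    (hs : 0 < s) (hns : (n : ℝ) ≤ (s : ℝ) ^ p) (hN : 0 < N) (hNn : N + D ^ (m + 1) * s ≤ n)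
    (hnL : n ≤ L) (ht : 0 ≤ t) :
    t * m ≤ (m + 1) * (2 * ((D ^ (m + 1) * s : ℕ) : ℝ) *
        ((S * (1 + (D ^ (m + 1) * s + 1) * r) : ℕ) * Real.log 2) / N
      + (Real.exp t - 1) * (δ + Real.exp (-(s / 4)))) := by
  set k := D ^ (m + 1) * s with hk
  have hD16 : (16 : ℝ) ≤ D := by nlinarith
  have hD1 : 1 ≤ D := by
    have : (1 : ℝ) ≤ D := by linarith
    exact_mod_cast this
  have : NeZero k := ⟨by positivity⟩
  have : NeZero N := ⟨hN.ne'⟩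
  have hNn' : N ≤ n := by omega
  -- Sizes grow by the factor `D` that separates windows; the largest is `k`, so one set of players
  -- serves all scales.
  set τ : Fin (m + 1) → ℕ := fun l => D ^ (l.val + 1) * s with hτ
  have hτk : ∀ l, τ l ≤ k := fun l =>
    Nat.mul_le_mul_right _ (Nat.pow_le_pow_right hD1 (by omega))
  have hsτ : ∀ l, s ≤ τ l := fun l => Nat.le_mul_of_pos_left _ (by positivity)
  set T : Fin (m + 1) → Finset (Fin k) := fun l => {i | i.val < τ l} with hT
  have hcard : ∀ l, #(T l) = τ l := fun l => by
    simp only [hT, Fin.card_filter_val_lt]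
    exact min_eq_right (hτk l)
  set E : Fin (m + 1) → Set ℝ := fun l => acceptable p ε (τ l) with hE
  have hlt : ∀ i j : Fin (m + 1), i < j → Disjoint (E i) (E j) := by
    intro i j hij
    refine disjoint_acceptable hp hε₁ hD hD16
      (Nat.cast_pos.2 (hs.trans_le (hsτ i))) ?_
    have : D * τ i ≤ τ j := by
      simp only [hτ]
      rw [← mul_assoc, ← pow_succ']
      exact Nat.mul_le_mul_right _ (Nat.pow_le_pow_right hD1 (by omega))
    exact_mod_cast this
  have hdisj : Pairwise fun i j => Disjoint (E i) (E j) := by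
    intro i j hij
    rcases lt_or_gt_of_ne hij with h | h
    · exact hlt i j h
    · exact (hlt j i h).symm
  set K : ℝ := 2 * (k : ℝ) * ((S * (1 + (k + 1) * r) : ℕ) * Real.log 2) / N with hK
  have hone : ∀ l, t * 𝔼 z : Fin N → Fin k, 𝔼 j, 𝔼 B, A.outputProb (playerStream hNn'
      (plantedInput z j (fun _ => false) B)) (E l)ᶜ
      ≤ K + (Real.exp t - 1) * (δ + Real.exp (-(s / 4))) := by
    intro l
    have h := A.mul_expect_outputProb_le (markedItems hNn') (List.finRange k) (T l) (E l)ᶜ ht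
    rw [Fintype.card_fin, Fintype.card_fin, List.length_finRange] at h
    refine h.trans (add_le_add_right (mul_le_mul_of_nonneg_left ?_ ?_) _)
    · refine expect_le univ_nonempty fun z _ => expect_le univ_nonempty fun j _ => ?_
      have h2 := expect_outputProb_planted_le hA hδ hε₀ hε₁.le (by linarith) hNn' (by omega)
        (T l) (hns.trans (Real.rpow_le_rpow (by positivity)
          (by rw [hcard]; exact_mod_cast hsτ l) (by linarith))) z j
      rw [hcard] at h2
      refine h2.trans ?_
      have : (s : ℝ) ≤ τ l := by exact_mod_cast hsτ l
      gcongr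
    · linarith [Real.add_one_le_exp t]
  -- The baseline does not depend on the scale, so the same output law is tested against all `m + 1`
  -- disjoint windows.
  calc t * m ≤ t * 𝔼 z : Fin N → Fin k, 𝔼 j, 𝔼 B, ∑ l, A.outputProb (playerStream hNn'
        (plantedInput z j (fun _ => false) B)) (E l)ᶜ := by
        refine mul_le_mul_of_nonneg_left ?_ ht
        refine le_expect univ_nonempty fun z _ => le_expect univ_nonempty fun j _ =>
          le_expect univ_nonempty fun B _ => ?_
        exact A.le_sum_outputProb_compl _ hdisj
    _ = ∑ l, t * 𝔼 z : Fin N → Fin k, 𝔼 j, 𝔼 B, A.outputProb (playerStream hNn'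
        (plantedInput z j (fun _ => false) B)) (E l)ᶜ := by
        simp only [expect_sum_comm]
        rw [mul_sum]
    _ ≤ ∑ _l : Fin (m + 1), (K + (Real.exp t - 1) * (δ + Real.exp (-(s / 4)))) :=
        sum_le_sum fun l _ => hone l
    _ = _ := by
        simp
        ring

end Scales

/-! ### Converting the trade-off into a space bound -/

section SpaceBound

/-- The error that the argument tolerates at scale `s`: both `δ` and the tail of a random half are
below it. -/
noncomputable def effectiveError (δ s : ℝ) : ℝ := max √δ (Real.exp (-(s / 8)))

theorem effectiveError_pos (δ s : ℝ) : 0 < effectiveError δ s :=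
  lt_max_of_lt_right (Real.exp_pos _)

/-- Both summands are squares of the terms in the maximum. If `√δ` is larger, the bound follows from
`√δ + exp (-(s / 8)) ≤ 1`; otherwise it follows from `exp (-(s / 8)) ≤ 1 / 2`. -/
theorem add_exp_le_effectiveError {δ δ₀ s : ℝ} (hδ : 0 ≤ δ) (hδ₀ : δ ≤ δ₀)
    (h2 : Real.exp (-(s / 8)) ≤ 1 / 2) (h1 : Real.exp (-(s / 8)) ≤ 1 - √δ₀) :
    δ + Real.exp (-(s / 4)) ≤ effectiveError δ s := by
  set x := Real.exp (-(s / 8)) with hx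
  have hx0 : 0 < x := Real.exp_pos _
  have hxx : Real.exp (-(s / 4)) = x * x := by
    rw [hx, ← Real.exp_add]
    ring_nf
  set y := √δ with hy
  have hyy : δ = y * y := (Real.mul_self_sqrt hδ).symm
  have hy0 : 0 ≤ y := Real.sqrt_nonneg _
  have hyq : y ≤ √δ₀ := Real.sqrt_le_sqrt hδ₀
  rw [hxx, effectiveError, ← hx, ← hy]
  rcases le_total x y with h | h
  · rw [max_eq_left h]
    nlinarith
  · rw [max_eq_right h]
    nlinarith

/-- The two terms of the effective error match the two terms of the minimum: the tail gives `s / 8`,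
with `s` at least `n ^ (1 / p)`, and `√δ` gives `log (1 / δ) / 2`. For `δ = 0` only the tail is
left. -/
theorem momentSpaceBound_le {n r : ℕ} {p δ s : ℝ} (hn : 1 ≤ n) (hδ : 0 ≤ δ) (hδ1 : δ ≤ 1)
    (hns : (n : ℝ) ^ (1 / p) ≤ s) :
    momentSpaceBound n r p δ
      ≤ (n : ℝ) ^ (1 - 2 / p) / r * (8 * -Real.log (effectiveError δ s)) := by
  have hn0 : (0 : ℝ) < n := by exact_mod_cast hn
  have hfac : 0 ≤ (n : ℝ) ^ (1 - 2 / p) / r := by positivity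
  have hpow : (n : ℝ) ^ (1 - 1 / p) / r ≤ (n : ℝ) ^ (1 - 2 / p) / r * s := by
    have : (n : ℝ) ^ (1 - 1 / p) = (n : ℝ) ^ (1 - 2 / p) * (n : ℝ) ^ (1 / p) := by
      rw [← Real.rpow_add hn0]
      congr 1
      ring
    rw [this, mul_div_right_comm]
    exact mul_le_mul_of_nonneg_left hns hfac
  rw [momentSpaceBound]
  split_ifs with h0
  · rw [effectiveError, h0, Real.sqrt_zero, max_eq_right (Real.exp_pos _).le, Real.log_exp]
    convert hpow using 2
    ring
  · have hδpos : 0 < δ := hδ.lt_of_ne (Ne.symm h0)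
    rcases le_total √δ (Real.exp (-(s / 8))) with h | h
    · rw [effectiveError, max_eq_right h, Real.log_exp]
      refine (min_le_left _ _).trans ?_
      exact hpow.trans (le_of_eq (by ring))
    · rw [effectiveError, max_eq_left h]
      refine (min_le_right _ _).trans ?_
      rw [mul_div_right_comm]
      refine mul_le_mul_of_nonneg_left ?_ hfac
      rw [Real.log_sqrt hδ, one_div, Real.log_inv]
      have := Real.log_nonpos hδ hδ1
      linarith

/-- At `t = -log w / 2` one has `exp t = 1 / √w`, so the left side is `√w * (1 - √w)`, and `1 - √w =
1 - exp (-t) ≤ t`. -/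
theorem exp_sub_one_mul_le {w : ℝ} (hw : 0 < w) :
    (Real.exp (-Real.log w / 2) - 1) * w ≤ -Real.log w / 2 * √w := by
  set t := -Real.log w / 2 with ht
  have h1 : Real.exp t * √w = 1 := by
    rw [← Real.exp_log (Real.sqrt_pos.2 hw), Real.log_sqrt hw.le, ← Real.exp_add, ht]
    ring_nf
    exact Real.exp_zero
  have h2 : √w * √w = w := Real.mul_self_sqrt hw.le
  have h3 : 1 - t ≤ √w := by
    have : √w = Real.exp (-t) := by
      rw [← Real.exp_log (Real.sqrt_pos.2 hw), Real.log_sqrt hw.le, ht]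
      ring_nf
    linarith [Real.add_one_le_exp (-t)]
  have h4 : (Real.exp t - 1) * w = √w * (1 - √w) := by
    calc (Real.exp t - 1) * w = (Real.exp t * √w) * √w - w := by rw [mul_assoc, h2]; ring
      _ = _ := by rw [h1]; linarith
  rw [h4]
  have := Real.sqrt_nonneg w
  nlinarith

theorem transcriptCost_le {k r S : ℕ} {G ν n N : ℝ} (hk : 1 ≤ k) (hr : 1 ≤ r) (hn : 0 < n)
    (hN : n ≤ 3 * N) (hkν : (k : ℝ) ≤ 2 * G * ν) :
    2 * (k : ℝ) * ((S * (1 + (k + 1) * r) : ℕ) * Real.log 2) / N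
      ≤ 72 * G ^ 2 * ν ^ 2 * r * S / n := by
  have h1 : ((S * (1 + (k + 1) * r) : ℕ) : ℝ) ≤ S * (3 * k * r) := by
    have : S * (1 + (k + 1) * r) ≤ S * (3 * k * r) := by
      refine Nat.mul_le_mul_left _ ?_
      nlinarith
    exact_mod_cast this
  have h2 : Real.log 2 ≤ 1 := by linarith [Real.log_two_lt_d9]
  have h3 : ((S * (1 + (k + 1) * r) : ℕ) : ℝ) * Real.log 2 ≤ S * (3 * k * r) * 1 :=
    mul_le_mul h1 h2 (Real.log_nonneg one_le_two) (by positivity)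
  calc 2 * (k : ℝ) * ((S * (1 + (k + 1) * r) : ℕ) * Real.log 2) / N
      ≤ 2 * (k : ℝ) * (S * (3 * k * r) * 1) / (n / 3) :=
        div_le_div₀ (by positivity) (mul_le_mul_of_nonneg_left h3 (by positivity)) (by positivity)
          (by linarith)
    _ = 18 * (k : ℝ) ^ 2 * r * S / n := by field_simp; ring
    _ ≤ 18 * (2 * G * ν) ^ 2 * r * S / n := by gcongr
    _ = _ := by ring

end SpaceBound

/-! ### Choice of parameters -/

theorem mainTheorem5 (ε p δ₀ : ℝ) (hε₀ : 0 < ε) (hε₁ : ε < 1) (hp : 2 ≤ p)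
    (hδ₀ : 0 < δ₀) (hδ₁ : δ₀ < 1) :
    ∃ c : ℝ, 0 < c ∧ ∃ n₀ : ℕ, ∀ n L r S : ℕ, ∀ δ : ℝ,
      n₀ ≤ n → n ≤ L → 1 ≤ r → 0 ≤ δ → δ ≤ δ₀ →
      ∀ A : StreamingAlgorithm n r S, A.EstimatesMoment L p ε δ →
        c * momentSpaceBound n r p δ ≤ (S : ℝ) := by
  set q := √δ₀ with hq
  have hq0 : 0 < q := Real.sqrt_pos.2 hδ₀
  have hq1 : q < 1 := by rw [hq, Real.sqrt_lt' one_pos]; simpa using hδ₁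
  have hqq1 : √q < 1 := by rw [Real.sqrt_lt' one_pos]; simpa using hq1
  -- Here `√q` is the fourth root of `δ₀`. For `δ₀` near 1 two windows do not suffice: `m / (m + 1)`
  -- must exceed `√q`, and `θ` is the gap.
  obtain ⟨m, hm⟩ := exists_nat_one_div_lt (sub_pos.2 hqq1)
  obtain ⟨D, hD⟩ := exists_nat_gt (64 / (1 - ε))
  have hD64 : 64 < (1 - ε) * D := by
    rw [div_lt_iff₀ (by linarith)] at hD
    linarith
  have hDpos : 0 < D := by
    refine Nat.pos_of_ne_zero fun h => ?_
    rw [h] at hD64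
    norm_num at hD64
  set G := D ^ (m + 1) with hG
  have hGpos : 0 < G := by positivity
  set θ : ℝ := 1 - 1 / ((m : ℝ) + 1) - √q with hθ
  have hθpos : 0 < θ := by rw [hθ]; linarith
  obtain ⟨s₀, hs₀⟩ : ∃ s₀ : ℕ, ∀ s : ℝ, s₀ ≤ s →
      Real.exp (-(s / 8)) ≤ 1 / 2 ∧ Real.exp (-(s / 8)) ≤ 1 - q ∧ Real.exp (-(s / 8)) ≤ q := by
    have hx : 0 < min (1 / 2) (min (1 - q) q) :=
      lt_min (by norm_num) (lt_min (by linarith) hq0)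
    obtain ⟨s₀, hs₀⟩ := exists_nat_ge (-(8 * Real.log (min (1 / 2) (min (1 - q) q))))
    refine ⟨s₀, fun s hs => ?_⟩
    have h : Real.exp (-(s / 8)) ≤ min (1 / 2) (min (1 - q) q) := by
      rw [← Real.le_log_iff_exp_le hx]
      linarith
    simpa only [le_min_iff] using h
  -- The factor 1152 is `72 * 16`: 72 from `transcriptCost_le`, and 16 since `8 * -log w = 16 * t`.
  -- In the threshold, `16 * G ^ 2` gives `2 * k ≤ n`, and the power of `s₀` gives `s₀ ≤ s`.
  refine ⟨θ / (1152 * G ^ 2), by positivity, max 16 (max (16 * G ^ 2) ⌈(s₀ : ℝ) ^ p⌉₊), ?_⟩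
  intro n L r S δ hn hnL hr hδ hδδ₀ A hA
  have hp0 : 0 < p := by linarith
  have hn16 : 16 ≤ n := (le_max_left _ _).trans hn
  have hnG : 16 * G ^ 2 ≤ n := ((le_max_left _ _).trans (le_max_right _ _)).trans hn
  have hns₀ : (s₀ : ℝ) ^ p ≤ n :=
    (Nat.le_ceil _).trans (by exact_mod_cast ((le_max_right _ _).trans (le_max_right _ _)).trans hn)
  have hn1 : (1 : ℝ) ≤ n := by exact_mod_cast (by omega : 1 ≤ n)
  have hn0 : (0 : ℝ) < n := by linarith
  set ν : ℝ := (n : ℝ) ^ (1 / p) with hν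
  have hν1 : 1 ≤ ν := Real.one_le_rpow hn1 (by positivity)
  have hνp : ν ^ p = n := by
    rw [hν, ← Real.rpow_mul hn0.le, one_div_mul_cancel hp0.ne', Real.rpow_one]
  -- The step that needs `p ≥ 2`: it leaves room for the `k` copies of the planted item in a stream
  -- of length `n`.
  have hν2 : ν ^ 2 ≤ n := by
    rw [← hνp, ← Real.rpow_natCast]
    exact Real.rpow_le_rpow_of_exponent_le hν1 (by exact_mod_cast hp)
  set s := ⌈ν⌉₊ with hs
  have hνs : ν ≤ s := Nat.le_ceil _
  have hs2 : (s : ℝ) ≤ 2 * ν := by linarith [Nat.ceil_lt_add_one (zero_le_one.trans hν1)]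
  have hspos : 0 < s := Nat.ceil_pos.2 (by linarith)
  have hs₀s : (s₀ : ℝ) ≤ s := by
    refine le_trans ?_ hνs
    rw [← hνp] at hns₀
    exact (Real.rpow_le_rpow_iff (Nat.cast_nonneg _) (by linarith) hp0).1 hns₀
  obtain ⟨hx2, hx1, hxq⟩ := hs₀ s hs₀s
  set k := G * s with hk
  have hk1 : 1 ≤ k := Nat.mul_pos hGpos hspos
  have hkν : (k : ℝ) ≤ 2 * G * ν := by
    rw [hk]
    push_cast
    linarith [mul_le_mul_of_nonneg_left hs2 (Nat.cast_nonneg (α := ℝ) G)]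
  have hkn : 2 * k ≤ n := by
    have h1 : (16 * (G : ℝ) ^ 2) ≤ n := by exact_mod_cast hnG
    have h2 : (4 * (G : ℝ) * ν) ^ 2 ≤ (n : ℝ) ^ 2 := by
      calc (4 * (G : ℝ) * ν) ^ 2 = (16 * (G : ℝ) ^ 2) * ν ^ 2 := by ring
        _ ≤ (n : ℝ) * n := by gcongr
        _ = _ := by ring
    have h3 := (pow_le_pow_iff_left₀ (by positivity) hn0.le two_ne_zero).1 h2
    have h4 : (2 * k : ℝ) ≤ n := by linarith
    exact_mod_cast h4
  set N := n / 2 with hN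
  have hNpos : 0 < N := by omega
  have hN3 : (n : ℝ) ≤ 3 * N := by exact_mod_cast (by omega : n ≤ 3 * N)
  set w := effectiveError δ s with hw
  have hw0 : 0 < w := effectiveError_pos _ _
  have hwq : w ≤ q := max_le (Real.sqrt_le_sqrt hδδ₀) hxq
  have hw1 : w ≤ 1 := hwq.trans hq1.le
  set t := -Real.log w / 2 with ht
  have ht0 : 0 ≤ t := by linarith [Real.log_nonpos hw0.le hw1]
  have hmain := memory_error_tradeoff (s := s) (m := m) (N := N) hA hδ hε₀.le hε₁
    (by linarith) hD64 hspos (by rw [← hνp]; exact Real.rpow_le_rpow (by linarith) hνs hp0.le)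
    hNpos (by rw [← hG, ← hk]; omega) hnL ht0
  rw [← hG, ← hk] at hmain
  set K : ℝ := 2 * (k : ℝ) * ((S * (1 + (k + 1) * r) : ℕ) * Real.log 2) / N with hK
  -- The error term is at most the fraction `√q` of `t`, uniformly in `δ ≤ δ₀`, so the left side of
  -- the trade-off dominates it.
  have herr : (Real.exp t - 1) * (δ + Real.exp (-(s / 4))) ≤ t * √q := by
    calc _ ≤ (Real.exp t - 1) * w := mul_le_mul_of_nonneg_left
          (add_exp_le_effectiveError hδ hδδ₀ hx2 hx1) (by linarith [Real.add_one_le_exp t])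
      _ ≤ t * √w := exp_sub_one_mul_le hw0
      _ ≤ t * √q := mul_le_mul_of_nonneg_left (Real.sqrt_le_sqrt hwq) ht0
  have hθt : θ * t ≤ K := by
    have hm1 : (0 : ℝ) < m + 1 := by positivity
    have h1 : t * m ≤ (m + 1) * (K + t * √q) :=
      hmain.trans (mul_le_mul_of_nonneg_left (by linarith) hm1.le)
    have h2 : (m + 1) * (θ * t) = t * m - (m + 1) * (t * √q) := by
      rw [hθ]
      field_simp
      ring
    exact le_of_mul_le_mul_left (by linarith) hm1
  have hr0 : (0 : ℝ) < r := by exact_mod_cast hr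
  have hKle : K ≤ 72 * (G : ℝ) ^ 2 * ν ^ 2 * r * S / n :=
    transcriptCost_le hk1 hr hn0 hN3 hkν
  have hpow : (n : ℝ) ^ (1 - 2 / p) * ν ^ 2 = n := by
    rw [hν, ← Real.rpow_natCast, ← Real.rpow_mul hn0.le, ← Real.rpow_add hn0,
      show 1 - 2 / p + 1 / p * ((2 : ℕ) : ℝ) = 1 by push_cast; ring, Real.rpow_one]
  calc θ / (1152 * G ^ 2) * momentSpaceBound n r p δ
      ≤ θ / (1152 * G ^ 2) * ((n : ℝ) ^ (1 - 2 / p) / r * (16 * t)) := by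
        refine mul_le_mul_of_nonneg_left ?_ (by positivity)
        refine (momentSpaceBound_le (by omega) hδ (hδδ₀.trans hδ₁.le) hνs).trans (le_of_eq ?_)
        rw [ht, hw]
        ring
    _ = (n : ℝ) ^ (1 - 2 / p) / (72 * G ^ 2 * r) * (θ * t) := by
        field_simp
        ring
    _ ≤ (n : ℝ) ^ (1 - 2 / p) / (72 * G ^ 2 * r) * (72 * G ^ 2 * ν ^ 2 * r * S / n) := by
        gcongr
        exact hθt.trans hKle
    _ = S * (((n : ℝ) ^ (1 - 2 / p) * ν ^ 2) / n) := by
        field_simp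
    _ = _ := by
        rw [hpow, div_self hn0.ne', mul_one]
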